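/- Let $G$ be a finitely generated group with finite generating set $S$ and let $p\ge 1$ be a real number. The $\ell^p$-isoperimetric profile of $G$ is \[ j_{p,G}(n)=\sup\Big\{\tfrac{\|f\|_p}{\|\nabla^l_S f\|_p} : f\colon G\to\mathbb R,\ f\ne 0,\ |\operatorname{supp} f|\le n\Big\}\in[0,\infty],\qquad \|\nabla^l_S f\|_p^p=\sum_{g\in G,\,s\in S}|f(sg)-f(g)|^p, \] where $a/0=\infty$ for $a>0$. For functions $f,g$ on $\mathbb N$ write $f\preccurlyeq g$ if there is $C>0$ with $f(n)=O(g(Cn))$ as $n\to\infty$, and $f\approx g$ if $f\preccurlyeq g\preccurlyeq f$. Let $\Gamma,\Lambda$ be countable groups. A fundamental domain for a measure-preserving action on a standard measure space $(\Omega,\mu)$ (standard Borel, $\mu$ nonzero and $\sigma$-finite) is a Borel set meeting almost every orbit in exactly one point; the action is smooth if a fundamental domain exists. A measure sub-quotient coupling from $\Gamma$ to $\Lambda$ is a triple $(\Omega,X_\Lambda,\mu)$, where $(\Omega,\mu)$ is a standard measure space with commuting measure-preserving smooth actions $*$ of $\Gamma$ and $\Lambda$, the $\Gamma$-action is essentially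 free, and $X_\Lambda$ is a fundamental domain of finite measure for the $\Lambda$-action. It is a measure quotient coupling if moreover the $\Gamma$-action has a fundamental domain of finite measure. A measure equivalence coupling from $\Gamma$ to $\Lambda$ is a quadruple $(\Omega,X_\Gamma,X_\Lambda,\mu)$ as above where both actions are essentially free and $X_\Gamma$, $X_\Lambda$ are finite measure fundamental domains for the $\Gamma$- and the $\Lambda$-action. For $x\in X_\Lambda$ and $\gamma\in\Gamma$, let $\gamma\cdot x$ be the point of $X_\Lambda$ in the $\Lambda$-orbit of $\gamma*x$. A sub-quotient coupling is at most $m$-to-one if for almost every $x\in X_\Lambda$ all fibres of $\gamma\mapsto\gamma^{-1}*(\gamma\cdot x)$ have at most $m$ elements. Suppose $\Lambda$ is generated by a finite set $S_\Lambda$. For $y\in\Lambda*x$ let $d_{S_\Lambda}(x,y)$ be the least length of a word in $S_\Lambda\cup S_\Lambda^{-1}$ taking $x$ to $y$. The coupling $(\Omega,X_\Lambda,\mu)$ is $\mathrm L^p$ if for every $\gamma\in\Gamma$ the fundamental domains $X_\Lambda$ and $\gamma*X_\Lambda$ are $\mathrm L^p$-equivalent, that is, for some $c>0$, \[\int_{X_\Lambda}\Big(\frac{d_{S_\Lambda}(x,x_\gamma)}{c}\Big)^p\,d\mu(x)<\infty,\]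 where $x_\gamma$ is the point of $\gamma*X_\Lambda$ in the $\Lambda$-orbit of $x$; this does not depend on $S_\Lambda$. A measure equivalence coupling is $(\mathrm L^p,\mathrm L^0)$ if $(\Omega,X_\Lambda,\mu)$ is $\mathrm L^p$ as a coupling from $\Gamma$ to $\Lambda$, and $(\mathrm L^p,\mathrm L^p)$ if in addition $(\Omega,X_\Gamma,\mu)$ is $\mathrm L^p$ as a coupling from $\Lambda$ to $\Gamma$. Theorem. Let $p\ge1$ be real and let $\Gamma,\Lambda$ be finitely generated groups, with profiles taken with respect to arbitrary finite generating sets. (i) If there is an $\mathrm L^p$ measure quotient coupling from $\Gamma$ to $\Lambda$, then $j_{p,\Lambda}\preccurlyeq j_{p,\Gamma}$. (ii) If, for some $m\in\mathbb N$, there is an at most $m$-to-one $\mathrm L^p$ measure sub-quotient coupling from $\Gamma$ to $\Lambda$, then $j_{p,\Lambda}\preccurlyeq j_{p,\Gamma}$. (iii) If there is an $(\mathrm L^p,\mathrm L^0)$ measure equivalence coupling from $\Gamma$ to $\Lambda$, then $j_{p,\Lambda}\preccurlyeq j_{p,\Gamma}$. (iv) If $\Gamma$ and $\Lambda$ are $\mathrm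 L^p$ measure equivalent, i.e. there is an $(\mathrm L^p,\mathrm L^p)$ measure equivalence coupling from $\Gamma$ to $\Lambda$, then $j_{p,\Gamma}\approx j_{p,\Lambda}$. -/

import Mathlib

open scoped ENNReal NNReal Pointwise
open MeasureTheory

universe u v w

noncomputable section

/-! ### The `ℓ^p`-isoperimetric profile -/

section Profile

variable {G : Type u} [Group G]

/-- The `ℓ^p`-norm of a real function on a group, as an extended nonnegative real. -/
def ellNorm (p : ℝ) (f : G → ℝ) : ℝ≥0∞ :=
  (∑' g : G, ‖f g‖ₑ ^ p) ^ (1 / p)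

/-- The `ℓ^p`-norm of the left gradient of `f` with respect to `S`. -/
def leftGradNorm (p : ℝ) (S : Finset G) (f : G → ℝ) : ℝ≥0∞ :=
  (∑' g : G, ∑ s ∈ S, ‖f (s * g) - f g‖ₑ ^ p) ^ (1 / p)

/-- The `ℓ^p`-isoperimetric profile with respect to `S`: the supremum of `‖f‖_p / ‖∇ f‖_p` over
nonzero `f` with support of size at most `n`. It takes the value `∞` exactly when some such `f`
has zero gradient, which for a generating set `S` happens only if `G` is finite and `|G| ≤ n`. -/
def isoProfile (p : ℝ) (S : Finset G) (n : ℕ) : ℝ≥0∞ :=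
  ⨆ (f : G → ℝ) (_ : f ≠ 0) (_ : (Function.support f).encard ≤ n),
    ellNorm p f / leftGradNorm p S f

end Profile

/-- `f ≼ g`: there is a constant `C > 0` with `f(n) = O(g(Cn))` as `n → ∞`. (For nondecreasing
functions it makes no difference whether `C` is an integer.) -/
def AsympLE (f g : ℕ → ℝ≥0∞) : Prop :=
  ∃ C : ℕ, 0 < C ∧ ∃ K : ℝ≥0, ∀ᶠ n in Filter.atTop, f n ≤ (K : ℝ≥0∞) * g (C * n)

/-- `f ≈ g`. -/
def AsympEquiv (f g : ℕ → ℝ≥0∞) : Prop :=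
  AsympLE f g ∧ AsympLE g f

/-! ### Smooth actions and fundamental domains -/

section Actions

variable (G : Type u) [Group G] {Ω : Type w} [MulAction G Ω]

/-- A Borel set meeting almost every orbit in exactly one point (the action need not be free, so
this is not Mathlib's `MeasureTheory.IsFundamentalDomain`). -/
def IsFundDomain [MeasurableSpace Ω] (μ : Measure Ω) (X : Set Ω) : Prop :=
  MeasurableSet X ∧
    ∃ Ω₀ : Set Ω, MeasurableSet Ω₀ ∧ μ Ω₀ᶜ = 0 ∧
      (∀ (g : G), ∀ ω ∈ Ω₀, g • ω ∈ Ω₀) ∧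
      ∀ ω ∈ Ω₀, ∃! x : Ω, x ∈ MulAction.orbit G ω ∩ X

/-- A measure-preserving action (of a countable discrete group) admitting a fundamental domain. -/
structure IsSmoothAction [MeasurableSpace Ω] (μ : Measure Ω) : Prop where
  measurable_smul : ∀ g : G, Measurable fun ω : Ω => g • ω
  measure_smul : ∀ (g : G) (E : Set Ω), MeasurableSet E → μ (g • E) = μ E
  exists_fundDomain : ∃ X : Set Ω, IsFundDomain G μ X

/-- An (essentially) free action. -/
def IsFreeAction [MeasurableSpace Ω] (μ : Measure Ω) : Prop :=
  ∀ g : G, g ≠ 1 → ∀ᵐ ω ∂μ, g • ω ≠ ω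

open Classical in
/-- The projection `π_X` to a fundamental domain: `ω` is sent to the point of its orbit that lies
in `X` (unique for almost every `ω`); `ω` itself is used if there is no such point. -/
def fundProj (X : Set Ω) (ω : Ω) : Ω :=
  if h : (MulAction.orbit G ω ∩ X).Nonempty then h.some else ω

variable {G}

/-- The Schreier graph metric: for `y` in the orbit of `x`, the least length of a word in
`S ∪ S⁻¹` taking `x` to `y`. -/
def schreierDist (S : Finset G) (x y : Ω) : ℕ :=
  sInf {n : ℕ | ∃ l : List G, l.length = n ∧ (∀ s ∈ l, s ∈ S ∨ s⁻¹ ∈ S) ∧ y = l.prod • x}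

/-- `φ`-equivalence of two fundamental domains, with respect to `S`. The quotient `Ω / G` carries
the measure obtained by identifying it with `X₁`; the point of `X₂` in the orbit of `x ∈ X₁` is
`fundProj G X₂ x`. -/
def PhiEquivalent [MeasurableSpace Ω] (φ : ℝ≥0 → ℝ≥0) (S : Finset G) (μ : Measure Ω)
    (X₁ X₂ : Set Ω) : Prop :=
  ∃ c : ℝ≥0, 0 < c ∧
    ∫⁻ x in X₁, (φ ((schreierDist S x (fundProj G X₂ x) : ℝ≥0) / c) : ℝ≥0∞) ∂μ < ∞

end Actions

/-! ### Couplings -/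

section Couplings

variable (Γ : Type u) (Λ : Type v) [Group Γ] [Group Λ]
variable {Ω : Type w} [MeasurableSpace Ω] [MulAction Γ Ω] [MulAction Λ Ω]

/-- `(Ω, X, μ)` is a measure sub-quotient coupling from `Γ` to `Λ`. -/
structure IsSubquotientCoupling (μ : Measure Ω) (X : Set Ω) : Prop where
  standardBorel : StandardBorelSpace Ω
  sigmaFinite : SigmaFinite μ
  measure_ne_zero : μ ≠ 0
  commute : ∀ (γ : Γ) (l : Λ) (ω : Ω), γ • l • ω = l • γ • ω
  smooth_left : IsSmoothAction Γ μ
  smooth_right : IsSmoothAction Λ μ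
  free_left : IsFreeAction Γ μ
  fundDomain : IsFundDomain Λ μ X
  finite_fundDomain : μ X < ∞

/-- `(Ω, X, μ)` is a measure quotient coupling from `Γ` to `Λ`: moreover the `Γ`-action has a
fundamental domain of finite measure. -/
def IsQuotientCoupling (μ : Measure Ω) (X : Set Ω) : Prop :=
  IsSubquotientCoupling Γ Λ μ X ∧ ∃ XΓ : Set Ω, IsFundDomain Γ μ XΓ ∧ μ XΓ < ∞

/-- `(Ω, XΓ, XΛ, μ)` is a measure equivalence coupling from `Γ` to `Λ`. -/
structure IsMECoupling (μ : Measure Ω) (XΓ XΛ : Set Ω) : Prop where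
  standardBorel : StandardBorelSpace Ω
  sigmaFinite : SigmaFinite μ
  measure_ne_zero : μ ≠ 0
  commute : ∀ (γ : Γ) (l : Λ) (ω : Ω), γ • l • ω = l • γ • ω
  smooth_left : IsSmoothAction Γ μ
  smooth_right : IsSmoothAction Λ μ
  free_left : IsFreeAction Γ μ
  free_right : IsFreeAction Λ μ
  fundDomain_left : IsFundDomain Γ μ XΓ
  fundDomain_right : IsFundDomain Λ μ XΛ
  finite_fundDomain_left : μ XΓ < ∞
  finite_fundDomain_right : μ XΛ < ∞

/-- `φ`-integrability of a coupling `(Ω, X, μ)` from `Γ` to `Λ`: for all `γ`, the fundamental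
domains `X` and `γ X` of the `Λ`-action are `φ`-equivalent, with respect to some finite generating
set of `Λ`. (For `φ(t) = t ^ p` the choice of the finite generating set is immaterial.) -/
def IsPhiIntegrable (φ : ℝ≥0 → ℝ≥0) (μ : Measure Ω) (X : Set Ω) : Prop :=
  ∃ S : Finset Λ, Subgroup.closure (S : Set Λ) = ⊤ ∧
    ∀ γ : Γ, PhiEquivalent φ S μ X (γ • X)

/-- `L^p` means `φ`-integrable for `φ(t) = t ^ p`. -/
def IsLpIntegrable (p : ℝ) (μ : Measure Ω) (X : Set Ω) : Prop :=
  IsPhiIntegrable Γ Λ (fun t => t ^ p) μ X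

variable {Γ} in
/-- The induced `Γ`-action on the fundamental domain `X` of the `Λ`-action: `γ · x` is the point
of `Λ γ x` in `X`. -/
def inducedSMul (X : Set Ω) (γ : Γ) (x : Ω) : Ω :=
  fundProj Λ X (γ • x)

/-- The coupling is at most `m`-to-one: for (almost) every `x ∈ X`, all fibres of
`γ ↦ γ⁻¹ (γ · x)` have at most `m` elements. -/
def IsAtMostToOne (m : ℕ) (μ : Measure Ω) (X : Set Ω) : Prop :=
  ∀ᵐ x ∂μ, x ∈ X → ∀ y : Ω, {γ : Γ | γ⁻¹ • inducedSMul Λ X γ x = y}.encard ≤ m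

end Couplings

section Relations

variable (p : ℝ) (Γ : Type u) (Λ : Type v) [Group Γ] [Group Λ]

/-- `Γ` is an `L^p` measure quotient of `Λ`. -/
def IsLpMeasureQuotient : Prop :=
  ∃ (Ω : Type w) (_ : MeasurableSpace Ω) (_ : MulAction Γ Ω) (_ : MulAction Λ Ω)
    (μ : Measure Ω) (X : Set Ω),
    IsQuotientCoupling Γ Λ μ X ∧ IsLpIntegrable Γ Λ p μ X

/-- `Γ` is an at most `m`-to-one `L^p` measure sub-quotient of `Λ`. -/
def IsAtMostToOneLpMeasureSubquotient (m : ℕ) : Prop :=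
  ∃ (Ω : Type w) (_ : MeasurableSpace Ω) (_ : MulAction Γ Ω) (_ : MulAction Λ Ω)
    (μ : Measure Ω) (X : Set Ω),
    IsSubquotientCoupling Γ Λ μ X ∧ IsAtMostToOne Γ Λ m μ X ∧ IsLpIntegrable Γ Λ p μ X

/-- There is an `(L^p, L^0)` measure equivalence coupling from `Γ` to `Λ`. -/
def HasLpLzeroMECoupling : Prop :=
  ∃ (Ω : Type w) (_ : MeasurableSpace Ω) (_ : MulAction Γ Ω) (_ : MulAction Λ Ω)
    (μ : Measure Ω) (XΓ XΛ : Set Ω),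
    IsMECoupling Γ Λ μ XΓ XΛ ∧ IsLpIntegrable Γ Λ p μ XΛ

/-- `Γ` and `Λ` are `L^p` measure equivalent: there is an `(L^p, L^p)` measure equivalence
coupling from `Γ` to `Λ`. -/
def AreLpMeasureEquivalent : Prop :=
  ∃ (Ω : Type w) (_ : MeasurableSpace Ω) (_ : MulAction Γ Ω) (_ : MulAction Λ Ω)
    (μ : Measure Ω) (XΓ XΛ : Set Ω),
    IsMECoupling Γ Λ μ XΓ XΛ ∧ IsLpIntegrable Γ Λ p μ XΛ ∧ IsLpIntegrable Λ Γ p μ XΓ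

end Relations

end

/-! ### Minkowski's inequality for `ellNorm`. -/

section Norms

variable {G : Type*} {p : ℝ}

/-! All four parts reduce to one statement about `L^p` sub-quotient couplings; the second half of
(iv) swaps the two groups. The task is to turn a finitely supported `f` on `Λ` into test functions
on `Γ`.

Let `F ω` be the `ℓ^p`-norm of `f` on the set of `l` with `l • ω ∈ X` (`orbitNorm`). If `Λ` acts
freely, `F ω` is just `|f l|` for the unique such `l`; the norm over all such `l` makes stabilizers
harmless. For `y` in a fundamental domain `Y` of `Γ`, test the profile of `Γ` on `γ ↦ F (γ • y)` and
integrate over `Y`. Unfolding along `Γ` turns these integrals into integrals over `Ω`: `∫ F ^ p =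
‖f‖_p ^ p * μ X`, while `F (s • ω) - F ω` is controlled by the displacement of `f` under a cocycle
into `Λ`. The cocycle is chosen of minimal word length, so the `L^p` condition bounds the integrated
gradient by a constant times `‖∇ f‖_p ^ p` (`exists_lintegral_orbitNorm_sub_le`).

The support of `γ ↦ F (γ • y)` still has to be bounded by `C * n`. It is at most the number of
returns of the orbit of `y` to the sets `a⁻¹ • X` with `a` in the support of `f`, and this number
has integral `|supp f| * μ X` over `Y`. The orbits with too many returns are discarded. By Markov
they come from a small part of `Y`, and since the return count is integrable on `Y`, they fill at
most half of each translate of `X` (`exists_measure_excessSet_le`). At least half of `∫ F ^ p`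
therefore survives. -/

lemma ellNorm_rpow (hp : 1 ≤ p) (f : G → ℝ) : ellNorm p f ^ p = ∑' g : G, ‖f g‖ₑ ^ p := by
  rw [ellNorm, ← ENNReal.rpow_mul, one_div, inv_mul_cancel₀ (by positivity), ENNReal.rpow_one]

lemma ellNorm_add_le (hp : 1 ≤ p) (f g : G → ℝ) :
    ellNorm p (f + g) ≤ ellNorm p f + ellNorm p g := by
  let _ : MeasurableSpace G := ⊤
  have key (h : G → ℝ) : ellNorm p h = eLpNorm h (ENNReal.ofReal p) Measure.count := by
    rw [eLpNorm_eq_lintegral_rpow_enorm_toReal (by simp; positivity) (by simp), lintegral_count,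
      ENNReal.toReal_ofReal (by positivity), ellNorm]
  simp only [key]
  exact eLpNorm_add_le (measurable_from_top.aestronglyMeasurable)
    (measurable_from_top.aestronglyMeasurable) (by simpa using hp)

lemma ellNorm_le_add_sub (hp : 1 ≤ p) (f g : G → ℝ) :
    ellNorm p f ≤ ellNorm p g + ellNorm p (f - g) := by
  simpa using ellNorm_add_le hp g (f - g)

lemma ellNorm_sub_comm (f g : G → ℝ) : ellNorm p (f - g) = ellNorm p (g - f) := by
  simp only [ellNorm, Pi.sub_apply, enorm_sub_rev]

lemma ellNorm_comp_equiv (f : G → ℝ) (e : G ≃ G) : ellNorm p (f ∘ e) = ellNorm p f := by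
  simp only [ellNorm, Function.comp_apply]
  rw [e.tsum_eq (fun g => ‖f g‖ₑ ^ p)]

lemma ellNorm_lt_top (hp : 1 ≤ p) {f : G → ℝ} (hf : (Function.support f).Finite) :
    ellNorm p f < ∞ := by
  rw [← ENNReal.rpow_lt_top_iff_of_pos (by positivity : 0 < p), ellNorm_rpow hp,
    tsum_eq_sum (s := hf.toFinset)]
  · exact ENNReal.sum_lt_top.2 fun g _ => ENNReal.rpow_lt_top_of_nonneg (by positivity) (by simp)
  · intro g hg
    have : f g = 0 := by simpa using hg
    simp [this, show 0 < p by positivity]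

/-- The reverse triangle inequality. -/
lemma enorm_toReal_ellNorm_sub_le (hp : 1 ≤ p) {f g : G → ℝ} (hf : ellNorm p f ≠ ∞)
    (hg : ellNorm p g ≠ ∞) :
    ‖(ellNorm p f).toReal - (ellNorm p g).toReal‖ₑ ≤ ellNorm p (f - g) := by
  by_cases h : ellNorm p (f - g) = ∞
  · simp [h]
  have h1 := ENNReal.toReal_mono (ENNReal.add_ne_top.2 ⟨hg, h⟩) (ellNorm_le_add_sub hp f g)
  have h2 := ENNReal.toReal_mono (ENNReal.add_ne_top.2 ⟨hf, h⟩)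
    (ellNorm_sub_comm (p := p) g f ▸ ellNorm_le_add_sub hp g f)
  rw [ENNReal.toReal_add hg h] at h1
  rw [ENNReal.toReal_add hf h] at h2
  rw [← ENNReal.ofReal_toReal h, Real.enorm_eq_ofReal_abs]
  exact ENNReal.ofReal_le_ofReal (abs_le.2 ⟨by linarith, by linarith⟩)

end Norms

/-! ### Displacements, gradients and words in generators. -/

section Words

variable {G : Type*} [Group G] {p : ℝ}

lemma leftGradNorm_rpow (hp : 1 ≤ p) (S : Finset G) (f : G → ℝ) :
    leftGradNorm p S f ^ p = ∑' g : G, ∑ s ∈ S, ‖f (s * g) - f g‖ₑ ^ p := by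
  rw [leftGradNorm, ← ENNReal.rpow_mul, one_div, inv_mul_cancel₀ (by positivity), ENNReal.rpow_one]

lemma leftGradNorm_ne_top (hp : 1 ≤ p) (S : Finset G) {f : G → ℝ}
    (hf : (Function.support f).Finite) : leftGradNorm p S f ≠ ∞ := by
  have h : leftGradNorm p S f ^ p = ∑ s ∈ S, ellNorm p ((fun g => f (s * g)) - f) ^ p := by
    rw [leftGradNorm_rpow hp, Summable.tsum_finsetSum (fun _ _ => ENNReal.summable)]
    simp only [ellNorm_rpow hp, Pi.sub_apply]
  rw [← lt_top_iff_ne_top, ← ENNReal.rpow_lt_top_iff_of_pos (by positivity : 0 < p), h]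
  refine ENNReal.sum_lt_top.2 fun s _ => ENNReal.rpow_lt_top_of_nonneg (by positivity)
    (ellNorm_lt_top hp (((hf.preimage (mul_right_injective s).injOn).union hf).subset ?_)).ne
  exact Function.support_sub _ _

lemma ellNorm_mul_left_sub_le_leftGradNorm (hp : 1 ≤ p) (S : Finset G) (f : G → ℝ) {s : G}
    (hs : s ∈ S) : ellNorm p ((fun g => f (s * g)) - f) ≤ leftGradNorm p S f := by
  rw [ellNorm, leftGradNorm]
  refine ENNReal.rpow_le_rpow (ENNReal.tsum_le_tsum fun g => ?_) (by positivity)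
  exact Finset.single_le_sum (f := fun s => ‖f (s * g) - f g‖ₑ ^ p) (fun _ _ => zero_le) hs

lemma ellNorm_inv_mul_left_sub (f : G → ℝ) (s : G) :
    ellNorm p ((fun g => f (s⁻¹ * g)) - f) = ellNorm p ((fun g => f (s * g)) - f) := by
  rw [← ellNorm_comp_equiv _ (Equiv.mulLeft s), ellNorm_sub_comm]
  congr 1
  ext g
  simp

/-- Translating by a word of length `k` moves `f` by at most `k` times the largest displacement of
`f` under a letter. -/
lemma ellNorm_list_prod_mul_sub_le (hp : 1 ≤ p) (S : Finset G) (f : G → ℝ) {D : ℝ≥0∞}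
    (hD : ∀ s ∈ S, ellNorm p ((fun g => f (s * g)) - f) ≤ D) (l : List G)
    (hl : ∀ s ∈ l, s ∈ S ∨ s⁻¹ ∈ S) :
    ellNorm p ((fun g => f (l.prod * g)) - f) ≤ l.length * D := by
  induction l with
  | nil => simp [ellNorm, show 0 < p by positivity]
  | cons s l ih =>
    have hs : ellNorm p ((fun g => f (s * g)) - f) ≤ D := by
      rcases hl s (by simp) with h | h
      · exact hD s h
      · simpa [ellNorm_inv_mul_left_sub] using hD _ h
    have hsplit : (fun g => f ((s :: l).prod * g)) - f =
        (((fun g => f (s * g)) - f) ∘ Equiv.mulLeft l.prod) +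
          ((fun g => f (l.prod * g)) - f) := by
      ext g; simp [mul_assoc]
    rw [hsplit]
    refine (ellNorm_add_le hp _ _).trans ?_
    rw [ellNorm_comp_equiv]
    refine (add_le_add hs (ih fun t ht => hl t (by simp [ht]))).trans_eq ?_
    push_cast [List.length_cons]; ring

lemma exists_word {S : Finset G} (hS : Subgroup.closure (S : Set G) = ⊤) (g : G) :
    ∃ l : List G, (∀ s ∈ l, s ∈ S ∨ s⁻¹ ∈ S) ∧ l.prod = g := by
  have hg : g ∈ (Subgroup.closure (S : Set G)).toSubmonoid := by simp [hS]
  rw [Subgroup.closure_toSubmonoid] at hg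
  obtain ⟨l, hl, h⟩ := Submonoid.exists_list_of_mem_closure hg
  exact ⟨l, by simpa using hl, h⟩

lemma countable_of_closure_eq_top {S : Finset G} (hS : Subgroup.closure (S : Set G) = ⊤) :
    Countable G := by
  let T : Type _ := {s : G // s ∈ S ∨ s⁻¹ ∈ S}
  have : Finite T := by
    refine Set.Finite.to_subtype (s := {s : G | s ∈ S ∨ s⁻¹ ∈ S}) ?_
    refine (S.finite_toSet).union ?_
    exact (S.finite_toSet).preimage inv_injective.injOn
  have : Function.Surjective (fun l : List T => (l.map Subtype.val).prod) := by
    intro g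
    obtain ⟨l, hl, rfl⟩ := exists_word hS g
    exact ⟨l.attach.map fun s => ⟨s.1, hl s.1 s.2⟩, by simp [List.map_map, Function.comp_def]⟩
  exact this.countable

/-- Displacements with respect to one finite set are controlled by the gradient with respect to
a finite generating set. -/
lemma exists_displacement_le (hp : 1 ≤ p) {S : Finset G} (hS : Subgroup.closure (S : Set G) = ⊤)
    (T : Finset G) : ∃ L : ℕ, ∀ f : G → ℝ, ∀ t ∈ T,
      ellNorm p ((fun g => f (t * g)) - f) ≤ L * leftGradNorm p S f := by
  choose l hl hlp using exists_word hS
  -- The sum of the word lengths serves as a common bound for all `t ∈ T`.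
  refine ⟨∑ t ∈ T, (l t).length, fun f t ht => ?_⟩
  have h := ellNorm_list_prod_mul_sub_le hp S f
    (fun s hs => ellNorm_mul_left_sub_le_leftGradNorm hp S f hs) (l t) (hl t)
  rw [hlp] at h
  refine h.trans ?_
  gcongr
  exact Finset.single_le_sum (f := fun t => (l t).length) (fun _ _ => Nat.zero_le _) ht

end Words

/-! ### From functions on `Λ` to functions on the coupling space. -/

section Coupling

variable {Γ Λ Ω : Type*} [Group Γ] [Group Λ] [MulAction Γ Ω] [MulAction Λ Ω]
variable {p : ℝ} {X : Set Ω}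

/-- The `ℓ^p`-norm of the restriction of `f` to the set of those `l` that carry `ω` into `X`. -/
noncomputable def orbitNorm (p : ℝ) (X : Set Ω) (f : Λ → ℝ) (ω : Ω) : ℝ≥0∞ :=
  ellNorm p ({l : Λ | l • ω ∈ X}.indicator f)

/-- The number of elements of `Γ` that carry `ω` into `X`. -/
noncomputable def returnCount (Γ : Type*) [Group Γ] [MulAction Γ Ω] (X : Set Ω) (ω : Ω) : ℝ≥0∞ :=
  ∑' γ : Γ, X.indicator 1 (γ • ω)

lemma returnCount_smul (γ : Γ) (ω : Ω) : returnCount Γ X (γ • ω) = returnCount Γ X ω := by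
  simp only [returnCount, smul_smul]
  exact (Equiv.mulRight γ).tsum_eq fun γ' => X.indicator (1 : Ω → ℝ≥0∞) (γ' • ω)

lemma orbitNorm_rpow (hp : 1 ≤ p) (f : Λ → ℝ) (ω : Ω) :
    orbitNorm p X f ω ^ p = ∑' l : Λ, ‖f l‖ₑ ^ p * X.indicator 1 (l • ω) := by
  rw [orbitNorm, ellNorm_rpow hp]
  refine tsum_congr fun l => ?_
  by_cases h : l • ω ∈ X <;> simp [h, show 0 < p by positivity]

lemma orbitNorm_ne_top (hp : 1 ≤ p) {f : Λ → ℝ} (hf : (Function.support f).Finite) (ω : Ω) :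
    orbitNorm p X f ω ≠ ∞ :=
  (ellNorm_lt_top hp (hf.subset (by simp))).ne

/-- A nonzero value at `γ` forces `a • γ • ω ∈ X` for some `a ∈ A`. Since the actions commute, `γ`
is then a return of `a • ω` to `X`. -/
lemma encard_support_orbitNorm_le [SMulCommClass Γ Λ Ω] (hp : 1 ≤ p) {f : Λ → ℝ} {A : Finset Λ}
    (hA : Function.support f ⊆ A) {ω : Ω} {N : ℕ}
    (hN : ∑ a ∈ A, returnCount Γ X (a • ω) ≤ N) :
    (Function.support fun γ : Γ => (orbitNorm p X f (γ • ω)).toReal).encard ≤ N := by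
  have key : ∀ γ : Γ,
      (Function.support fun γ : Γ => (orbitNorm p X f (γ • ω)).toReal).indicator 1 γ ≤
        ∑ a ∈ A, X.indicator (1 : Ω → ℝ≥0∞) (γ • a • ω) := by
    intro γ
    refine Set.indicator_le' (f := 1) (g := fun γ : Γ =>
      ∑ a ∈ A, X.indicator (1 : Ω → ℝ≥0∞) (γ • a • ω)) (fun γ hγ => ?_) (fun _ _ => zero_le) γ
    by_contra hlt
    apply hγ
    have h0 : ∀ a ∈ A, a • γ • ω ∉ X := by
      intro a ha haX
      apply hlt
      refine le_trans ?_ (Finset.single_le_sum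
        (f := fun a => X.indicator (1 : Ω → ℝ≥0∞) (γ • a • ω)) (fun _ _ => zero_le) ha)
      simp [smul_comm γ a ω, haX]
    have : {l : Λ | l • γ • ω ∈ X}.indicator f = 0 := by
      ext l
      by_cases hl : l ∈ A
      · simp [h0 l hl]
      · have : f l = 0 := by by_contra h; exact hl (hA h)
        simp [this]
    simp [orbitNorm, this, ellNorm, show 0 < p by positivity]
  have h := ENNReal.tsum_le_tsum key
  rw [← tsum_subtype, Summable.tsum_finsetSum (fun _ _ => ENNReal.summable)] at h
  simp only [Pi.one_apply, ENNReal.tsum_set_one] at h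
  have h' := h.trans hN
  exact_mod_cast h'

/-- If the orbits of `ω` and `s • ω` meet `X` in one point each, `orbitNorm` varies between `ω`
and `s • ω` at most by the displacement of `f` under the cocycle `α`. -/
lemma enorm_orbitNorm_sub_le [SMulCommClass Γ Λ Ω] (hp : 1 ≤ p) {f : Λ → ℝ}
    (hf : (Function.support f).Finite) (s : Γ) {ω : Ω} (hex : ∃ l : Λ, l • ω ∈ X)
    (huniq : ∀ l l' : Λ, l • ω ∈ X → l' • ω ∈ X → l • ω = l' • ω)
    (huniq' : ∀ l l' : Λ, l • s • ω ∈ X → l' • s • ω ∈ X → l • s • ω = l' • s • ω)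
    {α : Ω → Λ} (hα : ∀ l : Λ, l • ω ∈ X → α (l • ω) • s • l • ω ∈ X) :
    ‖(orbitNorm p X f (s • ω)).toReal - (orbitNorm p X f ω).toReal‖ₑ ^ p ≤
      ∑' l : Λ, X.indicator (fun x => ‖f (α x * l) - f l‖ₑ ^ p) (l • ω) := by
  obtain ⟨l₀, hl₀⟩ := hex
  set a := α (l₀ • ω) with ha
  have hmem (l : Λ) : (a * l) • s • ω ∈ X ↔ l • ω ∈ X := by
    have h0 := hα l₀ hl₀
    have e1 (k : Λ) : (a * k) • s • ω = a • s • k • ω := by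
      rw [mul_smul, smul_comm s k]
    constructor
    · intro h
      have := huniq' (a * l) (a * l₀) h (by rw [e1]; exact h0)
      rw [e1, e1, smul_left_cancel_iff, smul_left_cancel_iff] at this
      rwa [this]
    · intro h
      rw [e1, huniq l l₀ h hl₀]
      exact h0
  have e2 : orbitNorm p X f (s • ω) =
      ellNorm p ({l : Λ | l • ω ∈ X}.indicator fun l => f (a * l)) := by
    rw [orbitNorm, ← ellNorm_comp_equiv _ (Equiv.mulLeft a)]
    congr 1
    ext l
    by_cases h : l • ω ∈ X
    · rw [Set.indicator_of_mem (show l ∈ {l : Λ | l • ω ∈ X} from h), Function.comp_apply,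
        Equiv.coe_mulLeft, Set.indicator_of_mem]
      exact (hmem l).2 h
    · rw [Set.indicator_of_notMem (show l ∉ {l : Λ | l • ω ∈ X} from h), Function.comp_apply,
        Equiv.coe_mulLeft, Set.indicator_of_notMem]
      exact fun h' => h ((hmem l).1 h')
  have hfin : orbitNorm p X f (s • ω) ≠ ∞ := orbitNorm_ne_top hp hf _
  rw [e2] at hfin ⊢
  have := enorm_toReal_ellNorm_sub_le hp hfin (orbitNorm_ne_top (X := X) hp hf ω)
  refine (ENNReal.rpow_le_rpow this (by positivity)).trans_eq ?_
  rw [ellNorm_rpow hp]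
  refine tsum_congr fun l => ?_
  by_cases h : l • ω ∈ X
  · rw [Set.indicator_of_mem h, Pi.sub_apply, Set.indicator_of_mem (by exact h),
      Set.indicator_of_mem (by exact h), huniq l l₀ h hl₀]
  · simp [h, show 0 < p by positivity]

variable [MeasurableSpace Ω] {μ : Measure Ω}

lemma IsFundDomain.ae_orbit_inter (hX : IsFundDomain Λ μ X) :
    ∀ᵐ ω ∂μ, (∃ l : Λ, l • ω ∈ X) ∧
      ∀ l l' : Λ, l • ω ∈ X → l' • ω ∈ X → l • ω = l' • ω := by
  obtain ⟨-, Ω₀, -, h0, -, h⟩ := hX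
  filter_upwards [mem_ae_iff.2 h0] with ω hω
  obtain ⟨x, ⟨⟨l, rfl⟩, hx⟩, huniq⟩ := h ω hω
  refine ⟨⟨l, hx⟩, fun l l' hl hl' => ?_⟩
  exact (huniq _ ⟨⟨l, rfl⟩, hl⟩).trans (huniq _ ⟨⟨l', rfl⟩, hl'⟩).symm

lemma measurable_returnCount [Countable Γ] [MeasurableConstSMul Γ Ω] (hX : MeasurableSet X) :
    Measurable (returnCount Γ X) :=
  Measurable.tsum fun γ => (measurable_one.indicator hX).comp (measurable_const_smul γ)

lemma measurable_orbitNorm [Countable Λ] [MeasurableConstSMul Λ Ω] (hp : 1 ≤ p)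
    (hX : MeasurableSet X) (f : Λ → ℝ) : Measurable (orbitNorm p X f) := by
  have h : orbitNorm p X f =
      fun ω => (∑' l : Λ, ‖f l‖ₑ ^ p * X.indicator 1 (l • ω)) ^ (1 / p) := by
    ext ω
    rw [← orbitNorm_rpow hp, ← ENNReal.rpow_mul, mul_one_div_cancel (by positivity),
      ENNReal.rpow_one]
  rw [h]
  refine (Measurable.tsum fun l => ?_).pow_const _
  exact ((measurable_one.indicator hX).comp (measurable_const_smul l)).const_mul _

lemma setLIntegral_orbitNorm_rpow [Countable Λ] [MeasurableConstSMul Λ Ω] (hp : 1 ≤ p)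
    (hX : MeasurableSet X) (f : Λ → ℝ) (E : Set Ω) :
    ∫⁻ ω in E, orbitNorm p X f ω ^ p ∂μ =
      ∑' l : Λ, ‖f l‖ₑ ^ p * μ ((fun ω => l • ω) ⁻¹' X ∩ E) := by
  have hmeas (l : Λ) : Measurable fun ω : Ω => X.indicator (1 : Ω → ℝ≥0∞) (l • ω) :=
    (measurable_one.indicator hX).comp (measurable_const_smul l)
  simp only [orbitNorm_rpow hp]
  rw [lintegral_tsum fun l => ((hmeas l).const_mul _).aemeasurable]
  refine tsum_congr fun l => ?_
  rw [lintegral_const_mul _ (hmeas l)]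
  have hm : MeasurableSet ((fun ω => l • ω) ⁻¹' X) := measurable_const_smul l hX
  rw [← Measure.restrict_apply hm, ← lintegral_indicator_one hm]
  rfl

/-- Integrating the pointwise cocycle bound, the substitution `x = l • ω` in each term moves the
integral onto `X`; summing over `l` rebuilds the norm of the displacement of `f`. -/
lemma lintegral_orbitNorm_sub_le [Countable Λ] [SMulCommClass Γ Λ Ω] [MeasurableConstSMul Λ Ω]
    [SMulInvariantMeasure Λ Ω μ] [MeasurableConstSMul Γ Ω] [SMulInvariantMeasure Γ Ω μ]
    (hp : 1 ≤ p) (hX : IsFundDomain Λ μ X) {f : Λ → ℝ} (hf : (Function.support f).Finite)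
    (s : Γ) {α : Ω → Λ} (hαm : Measurable[_, ⊤] α) (hα : ∀ᵐ x ∂μ, x ∈ X → α x • s • x ∈ X) :
    ∫⁻ ω, ‖(orbitNorm p X f (s • ω)).toReal - (orbitNorm p X f ω).toReal‖ₑ ^ p ∂μ ≤
      ∫⁻ x in X, ellNorm p ((fun l => f (α x * l)) - f) ^ p ∂μ := by
  have hm (l : Λ) : Measurable fun x => ‖f (α x * l) - f l‖ₑ ^ p := by
    let _ : MeasurableSpace Λ := ⊤
    exact (measurable_from_top (f := fun a : Λ => ‖f (a * l) - f l‖ₑ ^ p)).comp hαm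
  have hα' : ∀ᵐ ω ∂μ, ∀ l : Λ, l • ω ∈ X → α (l • ω) • s • l • ω ∈ X :=
    ae_all_iff.2 fun l => (measurePreserving_smul l μ).quasiMeasurePreserving.ae hα
  calc _ ≤ ∫⁻ ω, ∑' l : Λ, X.indicator (fun x => ‖f (α x * l) - f l‖ₑ ^ p) (l • ω) ∂μ := by
        refine lintegral_mono_ae ?_
        filter_upwards [hX.ae_orbit_inter, hα',
          (measurePreserving_smul s μ).quasiMeasurePreserving.ae hX.ae_orbit_inter]
          with ω h1 h2 h3
        exact enorm_orbitNorm_sub_le hp hf s h1.1 h1.2 h3.2 h2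
    _ = ∑' l : Λ, ∫⁻ ω, X.indicator (fun x => ‖f (α x * l) - f l‖ₑ ^ p) (l • ω) ∂μ :=
        lintegral_tsum fun l =>
          (((hm l).indicator hX.1).comp (measurable_const_smul l)).aemeasurable
    _ = ∑' l : Λ, ∫⁻ x in X, ‖f (α x * l) - f l‖ₑ ^ p ∂μ := by
        refine tsum_congr fun l => ?_
        rw [(measurePreserving_smul l μ).lintegral_comp ((hm l).indicator hX.1),
          lintegral_indicator hX.1]
    _ = _ := by
        rw [← lintegral_tsum fun l => (hm l).aemeasurable]
        simp only [ellNorm_rpow hp, Pi.sub_apply]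

lemma exists_measurable_choice {ι : Type*} [Countable ι] [Nonempty ι] {T : ι → Set Ω}
    (hT : ∀ i, MeasurableSet (T i)) :
    ∃ α : Ω → ι, Measurable[_, ⊤] α ∧ ∀ x, (∃ i, x ∈ T i) → x ∈ T (α x) := by
  classical
  let _ : MeasurableSpace ι := ⊤
  obtain ⟨e, he⟩ := exists_surjective_nat ι
  -- The second alternative makes the search for the first index total, so that `Nat.find` is
  -- defined off the union of the `T i`.
  let P : Ω → ℕ → Prop := fun x n => x ∈ T (e n) ∨ ∀ i, x ∉ T i
  have hP : ∀ x, ∃ n, P x n := by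
    intro x
    by_cases h : ∃ i, x ∈ T i
    · obtain ⟨i, hi⟩ := h
      obtain ⟨n, rfl⟩ := he i
      exact ⟨n, Or.inl hi⟩
    · exact ⟨0, Or.inr (not_exists.1 h)⟩
  refine ⟨fun x => e (Nat.find (hP x)), measurable_from_top.comp (measurable_find hP fun n => ?_),
    fun x ⟨i, hi⟩ => ?_⟩
  · have : {x | P x n} = T (e n) ∪ ⋂ i, (T i)ᶜ := by ext x; simp [P]
    rw [this]
    exact (hT _).union (MeasurableSet.iInter fun i => (hT i).compl)
  · rcases Nat.find_spec (hP x) with h | h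
    · exact h
    · exact absurd hi (h i)

/-- A measurable choice of shortest words carrying `s • x` back to `X`. -/
lemma exists_measurable_word [Countable Λ] [SMulCommClass Γ Λ Ω] [MeasurableConstSMul Λ Ω]
    [MeasurableConstSMul Γ Ω] [SMulInvariantMeasure Γ Ω μ] (hX : IsFundDomain Λ μ X)
    {S : Finset Λ} (hS : Subgroup.closure (S : Set Λ) = ⊤) (s : Γ) :
    ∃ α : Ω → {l : List Λ // ∀ t ∈ l, t ∈ S ∨ t⁻¹ ∈ S}, Measurable[_, ⊤] α ∧
      ∀ᵐ x ∂μ, (α x).1.prod • s • x ∈ X ∧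
        (α x).1.length ≤ schreierDist S x (fundProj Λ (s⁻¹ • X) x) := by
  set W := {l : List Λ // ∀ t ∈ l, t ∈ S ∨ t⁻¹ ∈ S}
  have : Nonempty W := ⟨⟨[], by simp⟩⟩
  let V : W → Set Ω := fun l => {x | l.1.prod • s • x ∈ X}
  have hV (l : W) : MeasurableSet (V l) :=
    ((measurable_const_smul l.1.prod).comp (measurable_const_smul s)) hX.1
  -- The words of minimal length among those that work at `x`; measurability uses that there are
  -- only countably many words.
  let T : W → Set Ω := fun l => V l ∩ ⋂ l' : W, {x | x ∈ V l' → l.1.length ≤ l'.1.length}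
  have hT (l : W) : MeasurableSet (T l) := by
    refine (hV l).inter (MeasurableSet.iInter fun l' => ?_)
    by_cases h : l.1.length ≤ l'.1.length
    · simp [h]
    · simp only [h, imp_false]
      exact (hV l').compl
  obtain ⟨α, hαm, hα⟩ := exists_measurable_choice hT
  refine ⟨α, hαm, ?_⟩
  filter_upwards [(measurePreserving_smul s μ).quasiMeasurePreserving.ae hX.ae_orbit_inter]
    with x hx
  obtain ⟨⟨b, hb⟩, -⟩ := hx
  have hne : (MulAction.orbit Λ x ∩ s⁻¹ • X).Nonempty :=
    ⟨b • x, ⟨b, rfl⟩, by rw [Set.mem_inv_smul_set_iff, smul_comm]; exact hb⟩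
  have hproj : fundProj Λ (s⁻¹ • X) x ∈ MulAction.orbit Λ x ∩ s⁻¹ • X := by
    rw [fundProj, dif_pos hne]; exact hne.some_mem
  obtain ⟨⟨c, hc⟩, hmem⟩ := hproj
  obtain ⟨k, hk, rfl⟩ := exists_word hS c
  -- Since `S` generates, the set of lengths is nonempty, so the infimum is attained and is not the
  -- default value `0`.
  obtain ⟨l', hlen, hl', hprod⟩ := Nat.sInf_mem (s := {n : ℕ | ∃ l : List Λ, l.length = n ∧
    (∀ t ∈ l, t ∈ S ∨ t⁻¹ ∈ S) ∧ fundProj Λ (s⁻¹ • X) x = l.prod • x}) ⟨_, k, rfl, hk, hc.symm⟩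
  have hl'V : x ∈ V ⟨l', hl'⟩ := by
    rw [hprod, Set.mem_inv_smul_set_iff, smul_comm] at hmem
    exact hmem
  have hxT : x ∈ T (α x) := by
    refine hα x ?_
    obtain ⟨l, hl, hmin⟩ := exists_minimalFor_of_wellFoundedLT (fun l : W => x ∈ V l)
      (fun l : W => l.1.length) ⟨_, hl'V⟩
    refine ⟨l, hl, Set.mem_iInter.2 fun m hm => ?_⟩
    rcases le_total l.1.length m.1.length with h | h
    · exact h
    · exact hmin hm h
  refine ⟨hxT.1, ?_⟩
  rw [schreierDist, ← hlen]
  exact Set.mem_iInter.1 hxT.2 ⟨l', hl'⟩ hl'V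

/-- The gradient of `orbitNorm` in an `L^p` coupling. -/
lemma exists_lintegral_orbitNorm_sub_le [Countable Λ] [SMulCommClass Γ Λ Ω]
    [MeasurableConstSMul Λ Ω] [SMulInvariantMeasure Λ Ω μ] [MeasurableConstSMul Γ Ω]
    [SMulInvariantMeasure Γ Ω μ] (hp : 1 ≤ p) (hX : IsFundDomain Λ μ X)
    (hLp : IsLpIntegrable Γ Λ p μ X) {S : Finset Λ} (hS : Subgroup.closure (S : Set Λ) = ⊤)
    (s : Γ) : ∃ K : ℝ≥0∞, K ≠ ∞ ∧ ∀ f : Λ → ℝ, (Function.support f).Finite →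
      ∫⁻ ω, ‖(orbitNorm p X f (s • ω)).toReal - (orbitNorm p X f ω).toReal‖ₑ ^ p ∂μ ≤
        K * leftGradNorm p S f ^ p := by
  obtain ⟨T, hT, hLp⟩ := hLp
  -- The inverse appears because `l • s • x ∈ X` is equivalent to `l • x ∈ s⁻¹ • X`.
  obtain ⟨c, hc, hint⟩ := hLp s⁻¹
  obtain ⟨L, hL⟩ := exists_displacement_le hp hS T
  obtain ⟨α, hαm, hα⟩ := exists_measurable_word hX hT s
  have hp0 : 0 ≤ p := by positivity
  set I := ∫⁻ x in X, ((((schreierDist T x (fundProj Λ (s⁻¹ • X) x) : ℝ≥0) / c) ^ p : ℝ≥0) : ℝ≥0∞)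
    ∂μ with hI
  have hK : (c : ℝ≥0∞) ^ p * (L : ℝ≥0∞) ^ p ≠ ∞ :=
    ENNReal.mul_ne_top (ENNReal.rpow_ne_top_of_nonneg hp0 (by simp))
      (ENNReal.rpow_ne_top_of_nonneg hp0 (by simp))
  refine ⟨(c : ℝ≥0∞) ^ p * (L : ℝ≥0∞) ^ p * I, ENNReal.mul_ne_top hK hint.ne, fun f hf => ?_⟩
  have hαm' : Measurable[_, ⊤] fun x => (α x).1.prod :=
    @Measurable.comp _ _ _ _ ⊤ ⊤ (fun l : {l : List Λ // ∀ t ∈ l, t ∈ T ∨ t⁻¹ ∈ T} => l.1.prod) α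
      (@measurable_from_top _ _ ⊤ _) hαm
  refine (lintegral_orbitNorm_sub_le hp hX hf s hαm' (hα.mono fun x hx _ => hx.1)).trans ?_
  calc _ ≤ ∫⁻ x in X, leftGradNorm p S f ^ p * ((c : ℝ≥0∞) ^ p * (L : ℝ≥0∞) ^ p *
          ((((schreierDist T x (fundProj Λ (s⁻¹ • X) x) : ℝ≥0) / c) ^ p : ℝ≥0) : ℝ≥0∞)) ∂μ := by
        refine lintegral_mono_ae ?_
        filter_upwards [ae_restrict_of_ae hα] with x hx
        have h1 := ellNorm_list_prod_mul_sub_le hp T f (hL f) (α x).1 (α x).2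
        set d := schreierDist T x (fundProj Λ (s⁻¹ • X) x)
        have h2 : ((α x).1.length : ℝ≥0∞) ≤ c * ((d : ℝ≥0) / c : ℝ≥0) := by
          rw [← ENNReal.coe_mul, mul_div_cancel₀ _ hc.ne']
          exact_mod_cast hx.2
        have h3 := h1.trans (mul_le_mul_left h2 _)
        refine (ENNReal.rpow_le_rpow h3 hp0).trans_eq ?_
        rw [ENNReal.mul_rpow_of_nonneg _ _ hp0, ENNReal.mul_rpow_of_nonneg _ _ hp0,
          ENNReal.mul_rpow_of_nonneg _ _ hp0, ENNReal.coe_rpow_of_nonneg _ hp0]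
        ring
    _ = _ := by
        rw [lintegral_const_mul' _ _
          (ENNReal.rpow_ne_top_of_nonneg hp0 (leftGradNorm_ne_top hp S hf)),
          lintegral_const_mul' _ _ hK, mul_comm]

end Coupling

/-! ### Discarding orbits with too many returns and transferring the profile. -/

section Transfer

variable {Γ Λ Ω : Type*} [Group Γ] [Group Λ] [MulAction Γ Ω] [MulAction Λ Ω]
variable {p : ℝ} {X Y : Set Ω}

/-- The points whose `Γ`-orbit returns on average more than `C` times to the sets `a⁻¹ • X`, where
`a` runs over the finite set `A`. -/
def excessSet (Γ : Type*) [Group Γ] [MulAction Γ Ω] (X : Set Ω) (C : ℕ) (A : Finset Λ) : Set Ω :=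
  {ω | ((C * A.card : ℕ) : ℝ≥0∞) < ∑ a ∈ A, returnCount Γ X (a • ω)}

lemma smul_mem_excessSet_iff [SMulCommClass Γ Λ Ω] (C : ℕ) (A : Finset Λ) (γ : Γ) (ω : Ω) :
    γ • ω ∈ excessSet Γ X C A ↔ ω ∈ excessSet Γ X C A := by
  simp only [excessSet, Set.mem_ofPred_eq, ← smul_comm γ, returnCount_smul]

variable [MeasurableSpace Ω] {μ : Measure Ω}

/-- A point in two distinct translates of `Y` has two returns to `Y`; they coincide, giving a
nontrivial stabilizer element, which freeness excludes almost everywhere. -/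
lemma IsFundDomain.isFundamentalDomain [Countable Γ] (hY : IsFundDomain Γ μ Y)
    (hfree : IsFreeAction Γ μ) : IsFundamentalDomain Γ Y μ where
  nullMeasurableSet := hY.1.nullMeasurableSet
  ae_covers := hY.ae_orbit_inter.mono fun _ h => h.1
  aedisjoint := by
    intro g h hgh
    have hfree' : ∀ᵐ ω ∂μ, ∀ k : Γ, k ≠ 1 → k • ω ≠ ω :=
      ae_all_iff.2 fun k => by
        by_cases hk : k = 1
        · simp [hk]
        · filter_upwards [hfree k hk] with ω hω _ using hω
    refine measure_eq_zero_iff_ae_notMem.2 ?_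
    filter_upwards [hY.ae_orbit_inter, hfree'] with ω h1 h2 h3
    have := h1.2 g⁻¹ h⁻¹ (Set.mem_smul_set_iff_inv_smul_mem.1 h3.1)
      (Set.mem_smul_set_iff_inv_smul_mem.1 h3.2)
    refine h2 (h * g⁻¹) (fun h' => hgh (mul_inv_eq_one.1 h').symm) ?_
    rw [mul_smul, this, smul_inv_smul]

lemma lintegral_eq_setLIntegral_tsum [Countable Γ] [MeasurableConstSMul Γ Ω]
    [SMulInvariantMeasure Γ Ω μ] (hY : IsFundamentalDomain Γ Y μ) {h : Ω → ℝ≥0∞}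
    (hh : Measurable h) : ∫⁻ ω, h ω ∂μ = ∫⁻ y in Y, ∑' γ : Γ, h (γ • y) ∂μ := by
  rw [hY.lintegral_eq_tsum'', lintegral_tsum]
  exact fun γ => (hh.comp (measurable_const_smul γ)).aemeasurable

/-- Unfolding along `Γ` turns the left side into the measure of `l⁻¹ • X`. -/
lemma setLIntegral_returnCount_smul [Countable Γ] [MeasurableConstSMul Γ Ω]
    [SMulInvariantMeasure Γ Ω μ] [MeasurableConstSMul Λ Ω] [SMulInvariantMeasure Λ Ω μ]
    [SMulCommClass Γ Λ Ω] (hX : MeasurableSet X) (hY : IsFundamentalDomain Γ Y μ) (l : Λ) :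
    ∫⁻ y in Y, returnCount Γ X (l • y) ∂μ = μ X := by
  have hm : Measurable (X.indicator (1 : Ω → ℝ≥0∞)) := measurable_one.indicator hX
  rw [← lintegral_indicator_one hX, ← (measurePreserving_smul l μ).lintegral_comp hm,
    lintegral_eq_setLIntegral_tsum (h := fun ω => X.indicator 1 (l • ω)) hY
      (hm.comp (measurable_const_smul l))]
  simp only [returnCount, smul_comm _ l]

lemma measurableSet_excessSet [Countable Γ] [MeasurableConstSMul Γ Ω] [MeasurableConstSMul Λ Ω]
    (hX : MeasurableSet X) (C : ℕ) (A : Finset Λ) : MeasurableSet (excessSet Γ X C A) :=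
  measurableSet_lt measurable_const (Finset.measurable_fun_sum _ fun a _ =>
    (measurable_returnCount hX).comp (measurable_const_smul a))

/-- For large `C`, the excess sets occupy at most half of each translate of `X`: this follows from
Markov's inequality and the integrability of `returnCount` on a fundamental domain of `Γ`, which may
have infinite measure. -/
lemma exists_measure_excessSet_le [Countable Γ] [MeasurableConstSMul Γ Ω]
    [SMulInvariantMeasure Γ Ω μ] [MeasurableConstSMul Λ Ω] [SMulInvariantMeasure Λ Ω μ]
    [SMulCommClass Γ Λ Ω] (hX : MeasurableSet X) (hX0 : μ X ≠ 0) (hXfin : μ X ≠ ∞)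
    (hY : IsFundamentalDomain Γ Y μ) :
    ∃ C : ℕ, 0 < C ∧ ∀ (A : Finset Λ) (l : Λ),
      μ ((fun ω => l • ω) ⁻¹' X ∩ excessSet Γ X C A) ≤ μ X / 2 := by
  have hN : ∫⁻ y in Y, returnCount Γ X y ∂μ = μ X := by
    simpa using setLIntegral_returnCount_smul (Λ := Λ) hX hY 1
  -- Absolute continuity of the integral of `returnCount` over `Y`. The choice of `δ`, and then of
  -- `C` with `μ X < C * δ`, precedes `A` and `l`, so the bound is uniform in both.
  obtain ⟨δ, hδ, hsmall⟩ := exists_pos_setLIntegral_lt_of_measure_lt (hN.trans_ne hXfin)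
    (ε := μ X / 2) (by simpa using hX0)
  obtain ⟨C, hC⟩ := ENNReal.exists_nat_mul_gt hδ.ne' hXfin
  have hC0 : C ≠ 0 := by rintro rfl; simp at hC
  refine ⟨C, Nat.pos_of_ne_zero hC0, fun A l => ?_⟩
  rcases A.eq_empty_or_nonempty with rfl | hA
  · simp [excessSet]
  -- Moving the excess set by `l` replaces `A` by `A * l⁻¹`, which has the same cardinality, and
  -- reduces the claim to `μ (X ∩ E)`.
  set E := (fun ω : Ω => l⁻¹ • ω) ⁻¹' excessSet Γ X C A with hE
  have hEm : MeasurableSet E := measurable_const_smul l⁻¹ (measurableSet_excessSet hX C A)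
  have hmE : μ.restrict Y E < δ := by
    have hA0 : (A.card : ℝ≥0∞) ≠ 0 := by simpa using hA.ne_empty
    have hNm (a : Λ) : Measurable fun ω => returnCount Γ X ((a * l⁻¹) • ω) :=
      (measurable_returnCount hX).comp (measurable_const_smul (a * l⁻¹))
    have hmarkov := mul_meas_ge_le_lintegral (μ := μ.restrict Y)
      (Finset.measurable_fun_sum A fun a _ => hNm a) (C * A.card : ℕ)
    rw [lintegral_finsetSum _ fun a _ => hNm a] at hmarkov
    simp only [setLIntegral_returnCount_smul hX hY, Finset.sum_const, nsmul_eq_mul] at hmarkov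
    have h1 : (C : ℝ≥0∞) * μ.restrict Y E ≤ μ X := by
      have hsub : μ.restrict Y E ≤ μ.restrict Y
          {x | ((C * A.card : ℕ) : ℝ≥0∞) ≤ ∑ a ∈ A, returnCount Γ X ((a * l⁻¹) • x)} := by
        refine measure_mono fun x hx => ?_
        have hx' : ((C * A.card : ℕ) : ℝ≥0∞) < ∑ a ∈ A, returnCount Γ X (a • l⁻¹ • x) := hx
        simp only [smul_smul] at hx'
        exact hx'.le
      have h2 := (mul_le_mul_right hsub _).trans hmarkov
      rw [Nat.cast_mul, mul_comm (C : ℝ≥0∞), mul_assoc] at h2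
      exact (ENNReal.mul_le_mul_iff_right hA0 (by simp)).1 h2
    by_contra hle
    exact absurd (h1.trans_lt hC) (not_lt.2 (mul_le_mul_right (not_lt.1 hle) _))
  have hpre : (fun ω => l • ω) ⁻¹' X ∩ excessSet Γ X C A = (fun ω => l • ω) ⁻¹' (X ∩ E) := by
    ext ω; simp [hE]
  -- `E` is `Γ`-invariant, so its indicator leaves the sum over each orbit.
  have hXE : μ (X ∩ E) = ∫⁻ y in E, returnCount Γ X y ∂(μ.restrict Y) := by
    rw [← lintegral_indicator_one (hX.inter hEm),
      lintegral_eq_setLIntegral_tsum hY (measurable_one.indicator (hX.inter hEm)),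
      ← lintegral_indicator hEm]
    refine lintegral_congr fun y => ?_
    have hinv (γ : Γ) : γ • y ∈ E ↔ y ∈ E := by
      simp only [hE, Set.mem_preimage, ← smul_comm γ, smul_mem_excessSet_iff]
    by_cases hy : y ∈ E
    · rw [Set.indicator_of_mem hy, returnCount]
      refine tsum_congr fun γ => ?_
      by_cases h : γ • y ∈ X
      · simp [h, (hinv γ).2 hy]
      · simp [h]
    · simp [hy, hinv]
  rw [hpre, measure_preimage_smul, hXE]
  exact (hsmall E hmE).le

/-- Finiteness of the profile matters: with a vanishing gradient, `∞ * 0 = 0` would make the bound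
false. -/
lemma ellNorm_le_isoProfile_mul {G : Type*} [Group G] (hp : 1 ≤ p) (S : Finset G) {n : ℕ}
    {f : G → ℝ} (hf : (Function.support f).encard ≤ n) (hj : isoProfile p S n ≠ ∞) :
    ellNorm p f ≤ isoProfile p S n * leftGradNorm p S f := by
  by_cases h0 : f = 0
  · simp [h0, ellNorm, show 0 < p by positivity]
  have hfin : (Function.support f).Finite :=
    Set.finite_of_encard_le_coe hf
  have hle : ellNorm p f / leftGradNorm p S f ≤ isoProfile p S n :=
    le_iSup₂_of_le f h0 (le_iSup_of_le hf le_rfl)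
  exact (ENNReal.div_le_iff_le_mul (Or.inr hj) (Or.inl (leftGradNorm_ne_top hp S hfin))).1 hle

/-- Transfer of the isoperimetric profile along a coupling whose excess sets are small. -/
theorem asympLE_of_measure_excessSet_le [Countable Γ] [Countable Λ] [MeasurableConstSMul Γ Ω]
    [SMulInvariantMeasure Γ Ω μ] [MeasurableConstSMul Λ Ω] [SMulInvariantMeasure Λ Ω μ]
    [SMulCommClass Γ Λ Ω] (hp : 1 ≤ p) (hX : IsFundDomain Λ μ X) (hX0 : μ X ≠ 0)
    (hXfin : μ X ≠ ∞) (hY : IsFundamentalDomain Γ Y μ) (hLp : IsLpIntegrable Γ Λ p μ X)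
    (SΓ : Finset Γ) {SΛ : Finset Λ} (hSΛ : Subgroup.closure (SΛ : Set Λ) = ⊤)
    {C : ℕ} (hC0 : 0 < C) (hC : ∀ (A : Finset Λ) (l : Λ),
      μ ((fun ω => l • ω) ⁻¹' X ∩ excessSet Γ X C A) ≤ μ X / 2) :
    AsympLE (isoProfile p SΛ) (isoProfile p SΓ) := by
  have hp0 : 0 < p := by positivity
  choose K hKfin hK using exists_lintegral_orbitNorm_sub_le hp hX hLp hSΛ
  set M : ℝ≥0∞ := (∑ s ∈ SΓ, K s) / (μ X / 2) with hM
  have hX2 : μ X / 2 ≠ 0 := by simpa using hX0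
  have hX2' : μ X / 2 ≠ ∞ := ENNReal.div_ne_top hXfin (by simp)
  have hMfin : M ≠ ∞ := ENNReal.div_ne_top (ENNReal.sum_ne_top.2 fun s _ => hKfin s) hX2
  have hMp : M ^ (1 / p) ≠ ∞ := ENNReal.rpow_ne_top_of_nonneg (by positivity) hMfin
  -- Adding `1` keeps the constant nonzero, so that the right side is `∞` when the profile of `Γ`
  -- is.
  refine ⟨C, hC0, (M ^ (1 / p)).toNNReal + 1, Filter.Eventually.of_forall fun n => ?_⟩
  set j := isoProfile p SΓ (C * n) with hj
  by_cases hjtop : j = ∞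
  · rw [hjtop, ENNReal.mul_top (by simp)]
    exact le_top
  refine iSup₂_le fun f _ => iSup_le fun hfn => ENNReal.div_le_of_le_mul ?_
  have hf : (Function.support f).Finite := Set.finite_of_encard_le_coe hfn
  set A := hf.toFinset with hA
  have hAn : A.card ≤ n := by
    rw [hf.encard_eq_coe_toFinset_card] at hfn
    exact_mod_cast hfn
  set E := excessSet Γ X C A with hE
  have hEm : MeasurableSet E := measurableSet_excessSet hX.1 C A
  -- For each `l`, at least half of the preimage of `X` under `l` lies outside `E`.
  have hlower : ellNorm p f ^ p * (μ X / 2) ≤ ∫⁻ ω in Eᶜ, orbitNorm p X f ω ^ p ∂μ := by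
    rw [setLIntegral_orbitNorm_rpow hp hX.1, ellNorm_rpow hp, ← ENNReal.tsum_mul_right]
    refine ENNReal.tsum_le_tsum fun l => ?_
    gcongr
    have h1 := measure_inter_add_sdiff (μ := μ) ((fun ω => l • ω) ⁻¹' X) hEm
    rw [measure_preimage_smul] at h1
    rw [← Set.sdiff_eq]
    by_contra hlt
    have h2 := ENNReal.add_lt_add_of_le_of_lt (ne_top_of_le_ne_top hX2' (hC A l)) (hC A l)
      (not_le.1 hlt)
    rw [h1, ENNReal.add_halves] at h2
    exact lt_irrefl _ h2
  set h : Ω → ℝ≥0∞ := fun ω =>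
    ∑ s ∈ SΓ, ‖(orbitNorm p X f (s • ω)).toReal - (orbitNorm p X f ω).toReal‖ₑ ^ p with hh
  have hFm := measurable_orbitNorm hp hX.1 f
  have hsm (s : Γ) : Measurable fun ω =>
      ‖(orbitNorm p X f (s • ω)).toReal - (orbitNorm p X f ω).toReal‖ₑ ^ p :=
    (((hFm.comp (measurable_const_smul s)).ennreal_toReal.sub hFm.ennreal_toReal).enorm).pow_const _
  have hhm : Measurable h := Finset.measurable_fun_sum _ fun s _ => hsm s
  have hupper : ∫⁻ ω in Eᶜ, orbitNorm p X f ω ^ p ∂μ ≤ j ^ p * ∫⁻ ω, h ω ∂μ := by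
    rw [← lintegral_indicator hEm.compl,
      lintegral_eq_setLIntegral_tsum hY ((hFm.pow_const p).indicator hEm.compl),
      lintegral_eq_setLIntegral_tsum hY hhm,
      ← lintegral_const_mul' _ _ (ENNReal.rpow_ne_top_of_nonneg hp0.le hjtop)]
    refine lintegral_mono fun y => ?_
    -- By invariance of `E`, an orbit is either discarded whole or kept whole, so no cutoff enters
    -- the gradient.
    by_cases hy : y ∈ E
    · have : ∀ γ : Γ, (Eᶜ).indicator (fun ω => orbitNorm p X f ω ^ p) (γ • y) = 0 := fun γ =>
        Set.indicator_of_notMem (by simpa [hE, smul_mem_excessSet_iff] using hy) _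
      simp [this]
    · have hsupp : (Function.support fun γ : Γ => (orbitNorm p X f (γ • y)).toReal).encard ≤
          (C * n : ℕ) := by
        refine encard_support_orbitNorm_le hp (A := A) (by simp [hA])
          ((not_lt.1 (show ¬ _ < _ from hy)).trans ?_)
        exact_mod_cast Nat.mul_le_mul_left C hAn
      have hiso := ENNReal.rpow_le_rpow (ellNorm_le_isoProfile_mul hp SΓ hsupp hjtop) hp0.le
      rw [ENNReal.mul_rpow_of_nonneg _ _ hp0.le, ellNorm_rpow hp, leftGradNorm_rpow hp] at hiso
      simp only [mul_smul] at hiso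
      refine le_trans (ENNReal.tsum_le_tsum fun γ => ?_) hiso
      refine (Set.indicator_le_self _ _ _).trans_eq ?_
      rw [Real.enorm_of_nonneg ENNReal.toReal_nonneg,
        ENNReal.ofReal_toReal (orbitNorm_ne_top hp hf _)]
  have hgrad : ∫⁻ ω, h ω ∂μ ≤ (∑ s ∈ SΓ, K s) * leftGradNorm p SΛ f ^ p := by
    rw [hh, lintegral_finsetSum _ fun s _ => hsm s, Finset.sum_mul]
    exact Finset.sum_le_sum fun s _ => hK s f hf
  have hfinal : ellNorm p f ^ p ≤ M * (j ^ p * leftGradNorm p SΛ f ^ p) := by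
    have h1 := hlower.trans (hupper.trans (mul_le_mul_right hgrad _))
    rw [← ENNReal.le_div_iff_mul_le (Or.inl hX2) (Or.inl hX2')] at h1
    refine h1.trans_eq ?_
    rw [hM, ENNReal.div_eq_inv_mul, ENNReal.div_eq_inv_mul (b := μ X / 2)]
    ring
  have hroot := ENNReal.rpow_le_rpow hfinal (show 0 ≤ 1 / p by positivity)
  rw [ENNReal.mul_rpow_of_nonneg _ _ (by positivity), ENNReal.mul_rpow_of_nonneg _ _ (by positivity),
    ← ENNReal.rpow_mul, ← ENNReal.rpow_mul, ← ENNReal.rpow_mul, mul_one_div_cancel hp0.ne',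
    ENNReal.rpow_one, ENNReal.rpow_one, ENNReal.rpow_one, ← mul_assoc] at hroot
  refine hroot.trans ?_
  gcongr
  rw [ENNReal.coe_add, ENNReal.coe_toNNReal hMp]
  exact le_self_add

end Transfer

/-! ### From couplings to the four assertions. -/

section Main

variable {Γ Λ Ω : Type*} [Group Γ] [Group Λ] [MulAction Γ Ω] [MulAction Λ Ω] [MeasurableSpace Ω]
variable {p : ℝ} {X : Set Ω} {μ : Measure Ω}

lemma IsSmoothAction.measurableConstSMul (h : IsSmoothAction Γ μ) : MeasurableConstSMul Γ Ω :=
  ⟨h.measurable_smul⟩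

lemma IsSmoothAction.smulInvariantMeasure (h : IsSmoothAction Γ μ) :
    SMulInvariantMeasure Γ Ω μ :=
  ⟨fun g s hs => by rw [Set.preimage_smul]; exact h.measure_smul g⁻¹ s hs⟩

/-- If `X` were null, so would be the countable union of its translates, which is conull. -/
lemma IsFundDomain.measure_ne_zero [Countable Λ] [MeasurableConstSMul Λ Ω]
    [SMulInvariantMeasure Λ Ω μ] (hX : IsFundDomain Λ μ X) (hμ : μ ≠ 0) : μ X ≠ 0 := by
  intro h0
  apply hμ
  rw [← Measure.measure_univ_eq_zero, ← compl_compl Set.univ, ← mem_ae_iff]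
  have h : ∀ᵐ ω ∂μ, ∀ l : Λ, l • ω ∉ X := ae_all_iff.2 fun l =>
    (measurePreserving_smul l μ).quasiMeasurePreserving.ae (measure_eq_zero_iff_ae_notMem.1 h0)
  filter_upwards [h, hX.ae_orbit_inter] with ω h1 h2
  obtain ⟨l, hl⟩ := h2.1
  exact absurd hl (h1 l)

/-- Every `L^p` measure sub-quotient coupling transfers the profile. Neither a bound on the fibres
nor a fundamental domain of finite measure for `Γ` is needed: that `X` has finite measure already
makes the `Γ`-orbits return to `X` boundedly often on average. -/
theorem IsSubquotientCoupling.asympLE (hc : IsSubquotientCoupling Γ Λ μ X) (hp : 1 ≤ p)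
    (hLp : IsLpIntegrable Γ Λ p μ X) {SΓ : Finset Γ} {SΛ : Finset Λ}
    (hSΓ : Subgroup.closure (SΓ : Set Γ) = ⊤) (hSΛ : Subgroup.closure (SΛ : Set Λ) = ⊤) :
    AsympLE (isoProfile p SΛ) (isoProfile p SΓ) := by
  have := countable_of_closure_eq_top hSΓ
  have := countable_of_closure_eq_top hSΛ
  have := hc.smooth_left.measurableConstSMul
  have := hc.smooth_left.smulInvariantMeasure
  have := hc.smooth_right.measurableConstSMul
  have := hc.smooth_right.smulInvariantMeasure
  have : SMulCommClass Γ Λ Ω := ⟨hc.commute⟩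
  have hX0 := hc.fundDomain.measure_ne_zero hc.measure_ne_zero
  obtain ⟨Y, hY⟩ := hc.smooth_left.exists_fundDomain
  have hY' := hY.isFundamentalDomain hc.free_left
  obtain ⟨C, hC0, hC⟩ := exists_measure_excessSet_le (Λ := Λ) hc.fundDomain.1 hX0
    hc.finite_fundDomain.ne hY'
  exact asympLE_of_measure_excessSet_le hp hc.fundDomain hX0 hc.finite_fundDomain.ne hY' hLp SΓ
    hSΛ hC0 hC

theorem IsMECoupling.isSubquotientCoupling {XΓ XΛ : Set Ω} (h : IsMECoupling Γ Λ μ XΓ XΛ) :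
    IsSubquotientCoupling Γ Λ μ XΛ :=
  ⟨h.standardBorel, h.sigmaFinite, h.measure_ne_zero, h.commute, h.smooth_left, h.smooth_right,
    h.free_left, h.fundDomain_right, h.finite_fundDomain_right⟩

theorem IsMECoupling.swap {XΓ XΛ : Set Ω} (h : IsMECoupling Γ Λ μ XΓ XΛ) :
    IsMECoupling Λ Γ μ XΛ XΓ :=
  ⟨h.standardBorel, h.sigmaFinite, h.measure_ne_zero, fun l γ ω => (h.commute γ l ω).symm,
    h.smooth_right, h.smooth_left, h.free_right, h.free_left, h.fundDomain_right,
    h.fundDomain_left, h.finite_fundDomain_right, h.finite_fundDomain_left⟩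

end Main

theorem mainTheorem1 {Γ : Type u} {Λ : Type v} [Group Γ] [Group Λ]
    (SΓ : Finset Γ) (SΛ : Finset Λ)
    (hSΓ : Subgroup.closure (SΓ : Set Γ) = ⊤) (hSΛ : Subgroup.closure (SΛ : Set Λ) = ⊤)
    (p : ℝ) (hp : 1 ≤ p) :
    (IsLpMeasureQuotient.{u, v, w} p Γ Λ →
      AsympLE (isoProfile p SΛ) (isoProfile p SΓ)) ∧
    (∀ m : ℕ, IsAtMostToOneLpMeasureSubquotient.{u, v, w} p Γ Λ m →
      AsympLE (isoProfile p SΛ) (isoProfile p SΓ)) ∧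
    (HasLpLzeroMECoupling.{u, v, w} p Γ Λ →
      AsympLE (isoProfile p SΛ) (isoProfile p SΓ)) ∧
    (AreLpMeasureEquivalent.{u, v, w} p Γ Λ →
      AsympEquiv (isoProfile p SΓ) (isoProfile p SΛ)) := by
  refine ⟨?_, ?_, ?_, ?_⟩
  · rintro ⟨Ω, _, _, _, μ, X, ⟨hc, -⟩, hLp⟩
    exact hc.asympLE hp hLp hSΓ hSΛ
  · rintro m ⟨Ω, _, _, _, μ, X, hc, -, hLp⟩
    exact hc.asympLE hp hLp hSΓ hSΛ
  · rintro ⟨Ω, _, _, _, μ, XΓ, XΛ, hc, hLp⟩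
    exact hc.isSubquotientCoupling.asympLE hp hLp hSΓ hSΛ
  · rintro ⟨Ω, _, _, _, μ, XΓ, XΛ, hc, hLp, hLp'⟩
    exact ⟨hc.swap.isSubquotientCoupling.asympLE hp hLp' hSΛ hSΓ,
      hc.isSubquotientCoupling.asympLE hp hLp hSΓ hSΛ⟩
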